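/- Let $d,n\ge 0$ be integers, and let the orthogonal group $\mathrm{O}(d)=\{Q\in\mathbb R^{d\times d}: Q^\top Q=QQ^\top=I_d\}$ act on $\mathbb R^d$ by $v\mapsto Qv$ and on $(\mathbb R^d)^n$ by $Q\star(v_1,\dots,v_n)=(Qv_1,\dots,Qv_n)$. Let $h:(\mathbb R^d)^n\to\mathbb R^d$ be an arbitrary $\mathrm{O}(d)$-equivariant function, i.e. $h(Qv_1,\dots,Qv_n)=Q\,h(v_1,\dots,v_n)$ for all $Q\in\mathrm{O}(d)$ and all $v_1,\dots,v_n\in\mathbb R^d$. Then there are $n$ functions $f_1,\dots,f_n:(\mathbb R^d)^n\to\mathbb R$ that are $\mathrm{O}(d)$-invariant, i.e. $f_t(Qv_1,\dots,Qv_n)=f_t(v_1,\dots,v_n)$ for all $Q\in\mathrm{O}(d)$ and all $v_1,\dots,v_n$, such that $$h(v_1,\dots,v_n)=\sum_{t=1}^n f_t(v_1,\dots,v_n)\,v_t\qquad\text{for all } v_1,\dots,v_n\in\mathbb R^d.$$ Moreover, if $h$ is polynomial (each coordinate of $h$ is a real polynomial in the $nd$ entries of $v_1,\dots,v_n$), then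 $\mathrm{O}(d)$-invariant functions $f_1,\dots,f_n$ satisfying this identity can be chosen such that each $f_t$ is a real polynomial in the entries of $v_1,\dots,v_n$ and, moreover, is of the form $f_t(v_1,\dots,v_n)=g_t\big((v_i^\top v_j)_{i,j=1}^n\big)$ for a real polynomial $g_t$ in $n^2$ variables. -/

import Mathlib

open scoped Matrix

/-- The tuples `(v₁, …, vₙ)` of `n` vectors of `ℝ^d`. -/
abbrev VecTuple (d n : ℕ) : Type := Fin n → Fin d → ℝ

/-- The diagonal action `Q ⋆ (v₁, …, vₙ) = (Q v₁, …, Q vₙ)`. -/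
def rotate {d n : ℕ} (Q : Matrix.orthogonalGroup (Fin d) ℝ) (v : VecTuple d n) : VecTuple d n :=
  fun i => (Q : Matrix (Fin d) (Fin d) ℝ) *ᵥ v i

/-- `f : (ℝ^d)^n → ℝ` is `O(d)`-invariant. -/
def IsOInvariant {d n : ℕ} (f : VecTuple d n → ℝ) : Prop :=
  ∀ (Q : Matrix.orthogonalGroup (Fin d) ℝ) (v : VecTuple d n), f (rotate Q v) = f v

/-- `h : (ℝ^d)^n → ℝ^d` is `O(d)`-equivariant. -/
def IsOEquivariant {d n : ℕ} (h : VecTuple d n → Fin d → ℝ) : Prop :=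
  ∀ (Q : Matrix.orthogonalGroup (Fin d) ℝ) (v : VecTuple d n),
    h (rotate Q v) = (Q : Matrix (Fin d) (Fin d) ℝ) *ᵥ h v

/-- `f : (ℝ^d)^n → ℝ` is given by a real polynomial in the `n * d` entries of the vectors. -/
def IsPolynomialScalar {d n : ℕ} (f : VecTuple d n → ℝ) : Prop :=
  ∃ p : MvPolynomial (Fin n × Fin d) ℝ, ∀ v : VecTuple d n,
    f v = MvPolynomial.eval (fun ik => v ik.1 ik.2) p

/-- `h : (ℝ^d)^n → ℝ^d` is a polynomial map: each of its `d` coordinates is polynomial. -/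
def IsPolynomialVector {d n : ℕ} (h : VecTuple d n → Fin d → ℝ) : Prop :=
  ∀ k : Fin d, IsPolynomialScalar (fun v => h v k)

/-- `f : (ℝ^d)^n → ℝ` is given by a real polynomial in the inner products `vᵢᵀ vⱼ`. -/
def IsPolynomialInInnerProducts {d n : ℕ} (f : VecTuple d n → ℝ) : Prop :=
  ∃ g : MvPolynomial (Fin n × Fin n) ℝ, ∀ v : VecTuple d n,
    f v = MvPolynomial.eval (fun ij => v ij.1 ⬝ᵥ v ij.2) g

/-! The reflection in the span of the `v t` fixes every `v t`, hence fixes `h v`, so `h v` lies in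
that span. Coefficients chosen at one representative per orbit and transported along the orbit are
invariant.

If `h` is polynomial, `h v ⬝ᵥ w` is an invariant polynomial of the `n + 1` vectors `w, v`. By the
first fundamental theorem (`IsOInvariant.mem_gramAlgebra`) it is a polynomial in inner products, and
its part of first order in `w` has the form `∑ t, g t v * (v t ⬝ᵥ w)`; the `g t` are the
coefficients.

The fundamental theorem comes from averaging `f (G v)` over matrices `G` with independent standard
Gaussian entries. By Wick's formula the average is a polynomial in inner products, of no larger
degree. On the finite-dimensional space of invariants of degree at most `k` averaging is injective,
hence surjective, so every invariant is an average. Injectivity is a positivity argument with the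
kernel `(1 + ∑ i, v i ⬝ᵥ w i) ^ k` and the polar decomposition of `G`. -/

/-! ### Orthogonal matrices and polar decomposition -/

/-- The matrix of a linear isometry of Euclidean space is orthogonal. -/
theorem LinearIsometry.exists_orthogonalGroup_mulVec {d : ℕ}
    (φ : EuclideanSpace ℝ (Fin d) →ₗᵢ[ℝ] EuclideanSpace ℝ (Fin d)) :
    ∃ Q : Matrix.orthogonalGroup (Fin d) ℝ, ∀ x : EuclideanSpace ℝ (Fin d),
      (Q : Matrix (Fin d) (Fin d) ℝ) *ᵥ x.ofLp = (φ x).ofLp := by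
  set M : Matrix (Fin d) (Fin d) ℝ := (Matrix.toEuclideanLin).symm φ.toLinearMap with hM
  have hφ : ∀ x : EuclideanSpace ℝ (Fin d), M *ᵥ x.ofLp = (φ x).ofLp := by
    intro x
    have : Matrix.toEuclideanLin M x = φ x := by rw [hM, LinearEquiv.apply_symm_apply]; rfl
    rw [← this]; rfl
  have hMM : Mᵀ * M = 1 := by
    refine Matrix.ext_of_mulVec_single fun j => ?_
    refine dotProduct_eq _ _ fun y => ?_
    have := φ.inner_map_map (WithLp.toLp 2 y) (WithLp.toLp 2 (Pi.single j (1 : ℝ)))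
    rw [EuclideanSpace.inner_eq_star_dotProduct, EuclideanSpace.inner_eq_star_dotProduct,
      ← hφ, ← hφ] at this
    simp only [star_trivial] at this
    rw [Matrix.one_mulVec, ← this, ← Matrix.mulVec_mulVec, Matrix.mulVec_transpose,
      ← Matrix.dotProduct_mulVec]
  exact ⟨⟨M, (Matrix.mem_orthogonalGroup_iff' _ _).2 hMM⟩, hφ⟩

/-- Two square matrices with the same Gram matrix differ by an orthogonal factor. -/
theorem Matrix.exists_orthogonalGroup_mul_eq {d : ℕ} {A S : Matrix (Fin d) (Fin d) ℝ}
    (h : Aᵀ * A = Sᵀ * S) :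
    ∃ Q : Matrix.orthogonalGroup (Fin d) ℝ, A = (Q : Matrix (Fin d) (Fin d) ℝ) * S := by
  have hnorm : ∀ x, ‖Matrix.toEuclideanLin A x‖ = ‖Matrix.toEuclideanLin S x‖ := by
    intro x
    have key : ∀ B : Matrix (Fin d) (Fin d) ℝ,
        ‖Matrix.toEuclideanLin B x‖ ^ 2 = x.ofLp ⬝ᵥ ((Bᵀ * B) *ᵥ x.ofLp) := by
      intro B
      rw [← real_inner_self_eq_norm_sq, EuclideanSpace.inner_eq_star_dotProduct]
      simp [Matrix.toLpLin_apply, ← Matrix.mulVec_mulVec, Matrix.dotProduct_mulVec,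
        Matrix.vecMul_transpose]
    rw [← sq_eq_sq₀ (norm_nonneg _) (norm_nonneg _), key, key, h]
  -- With `g` a linear section of `S` over its range, `A ∘ g` is isometric there and extends to the
  -- whole space.
  obtain ⟨g, hg⟩ := (Matrix.toEuclideanLin S).rangeRestrict.exists_rightInverse_of_surjective
    (LinearMap.range_rangeRestrict _)
  have hg' : ∀ y, Matrix.toEuclideanLin S (g y) = y := fun y =>
    congrArg Subtype.val (LinearMap.congr_fun hg y)
  let L : LinearMap.range (Matrix.toEuclideanLin S) →ₗᵢ[ℝ] EuclideanSpace ℝ (Fin d) :=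
    ⟨Matrix.toEuclideanLin A ∘ₗ g, fun y => by
      rw [LinearMap.comp_apply, hnorm, hg']; rfl⟩
  obtain ⟨Q, hQ⟩ := L.extend.exists_orthogonalGroup_mulVec
  refine ⟨Q, Matrix.ext_of_mulVec_single fun j => ?_⟩
  set x : EuclideanSpace ℝ (Fin d) := WithLp.toLp 2 (Pi.single j (1 : ℝ))
  have h1 : L.extend (Matrix.toEuclideanLin S x) = Matrix.toEuclideanLin A x := by
    refine (L.extend_apply ⟨_, LinearMap.mem_range_self _ x⟩).trans ?_
    change Matrix.toEuclideanLin A (g _) = _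
    -- `g (S x)` and `x` differ by an element of `ker S`, which `A` also kills by `hnorm`.
    rw [← sub_eq_zero, ← map_sub, ← norm_eq_zero, hnorm, map_sub, hg', sub_self, norm_zero]
  have h2 := hQ (Matrix.toEuclideanLin S x)
  rw [h1] at h2
  rw [← Matrix.mulVec_mulVec]
  exact h2.symm

open scoped MatrixOrder Matrix.Norms.L2Operator in
/-- Polar decomposition, with the positive semidefinite factor written as `Bᵀ * B`. -/
theorem Matrix.exists_orthogonalGroup_mul_transpose_mul_self {d : ℕ}
    (A : Matrix (Fin d) (Fin d) ℝ) :
    ∃ (Q : Matrix.orthogonalGroup (Fin d) ℝ) (B : Matrix (Fin d) (Fin d) ℝ),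
      A = (Q : Matrix (Fin d) (Fin d) ℝ) * (Bᵀ * B) := by
  have hA : 0 ≤ Aᵀ * A := by
    rw [Matrix.nonneg_iff_posSemidef]
    simpa using Matrix.posSemidef_conjTranspose_mul_self A
  have hS := CFC.sqrt_nonneg (Aᵀ * A)
  have hSS := CFC.sqrt_mul_sqrt_self (Aᵀ * A) hA
  obtain ⟨B, hB⟩ := CStarAlgebra.nonneg_iff_eq_star_mul_self.1 hS
  have hB' : CFC.sqrt (Aᵀ * A) = Bᵀ * B := hB
  have hT : (Bᵀ * B)ᵀ = Bᵀ * B := by simp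
  obtain ⟨Q, hQ⟩ := Matrix.exists_orthogonalGroup_mul_eq (A := A) (S := Bᵀ * B)
    (by rw [hT, ← hB', hSS])
  exact ⟨Q, B, hQ⟩

/-! ### Orbits and arbitrary equivariant maps -/

theorem rotate_mul {d n : ℕ} (P Q : Matrix.orthogonalGroup (Fin d) ℝ) (v : VecTuple d n) :
    rotate (P * Q) v = rotate P (rotate Q v) := by
  ext i; simp [rotate, Matrix.mulVec_mulVec]

theorem rotate_one {d n : ℕ} (v : VecTuple d n) : rotate 1 v = v := by
  ext i; simp [rotate]

/-- The orbit relation of `O(d)` on tuples of vectors. -/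
def rotateSetoid (d n : ℕ) : Setoid (VecTuple d n) where
  r v w := ∃ Q : Matrix.orthogonalGroup (Fin d) ℝ, rotate Q v = w
  iseqv :=
    { refl := fun v => ⟨1, rotate_one v⟩
      symm := by
        rintro v _ ⟨Q, rfl⟩
        exact ⟨Q⁻¹, by rw [← rotate_mul, inv_mul_cancel, rotate_one]⟩
      trans := by
        rintro v _ _ ⟨Q, rfl⟩ ⟨P, rfl⟩
        exact ⟨P * Q, rotate_mul P Q v⟩ }

/-- An equivariant map takes values in the span of its arguments. -/
theorem IsOEquivariant.exists_eq_sum_smul {d n : ℕ} {h : VecTuple d n → Fin d → ℝ}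
    (hh : IsOEquivariant h) (v : VecTuple d n) :
    ∃ c : Fin n → ℝ, h v = ∑ t, c t • v t := by
  set U : Submodule ℝ (EuclideanSpace ℝ (Fin d)) :=
    Submodule.span ℝ (Set.range fun t => WithLp.toLp 2 (v t)) with hU
  obtain ⟨Q, hQ⟩ := (U.reflection).toLinearIsometry.exists_orthogonalGroup_mulVec
  have hv : rotate Q v = v := by
    funext t
    have hmem : WithLp.toLp 2 (v t) ∈ U := Submodule.subset_span ⟨t, rfl⟩
    refine (hQ (WithLp.toLp 2 (v t))).trans ?_
    exact congrArg WithLp.ofLp ((U.reflection_eq_self_iff _).2 hmem)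
  have h1 := hh Q v
  rw [hv] at h1
  have h2 : U.reflection (WithLp.toLp 2 (h v)) = WithLp.toLp 2 (h v) :=
    congrArg (WithLp.toLp 2) ((hQ (WithLp.toLp 2 (h v))).symm.trans h1.symm)
  obtain ⟨c, hc⟩ := (Submodule.mem_span_range_iff_exists_fun ℝ).1 ((U.reflection_eq_self_iff _).1 h2)
  refine ⟨c, ?_⟩
  have := congrArg WithLp.ofLp hc
  simpa using this.symm

/-- The coefficients can be taken `O(d)`-invariant. -/
theorem IsOEquivariant.exists_invariant_coeff {d n : ℕ} {h : VecTuple d n → Fin d → ℝ}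
    (hh : IsOEquivariant h) :
    ∃ f : Fin n → VecTuple d n → ℝ,
      (∀ t, IsOInvariant (f t)) ∧ ∀ v : VecTuple d n, h v = ∑ t, f t v • v t := by
  choose c hc using fun v => hh.exists_eq_sum_smul v
  let rep : VecTuple d n → VecTuple d n := fun v =>
    (Quotient.mk (rotateSetoid d n) v).out
  refine ⟨fun t v => c (rep v) t, fun t Q v => ?_, fun v => ?_⟩
  · have : Quotient.mk (rotateSetoid d n) (rotate Q v) = Quotient.mk (rotateSetoid d n) v :=
      Quotient.sound ((rotateSetoid d n).symm ⟨Q, rfl⟩)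
    simp only [rep, this]
  · obtain ⟨Q, hQ⟩ : ∃ Q, rotate Q (rep v) = v :=
      Quotient.exact (Quotient.out_eq (Quotient.mk (rotateSetoid d n) v))
    calc h v = h (rotate Q (rep v)) := by rw [hQ]
      _ = (Q : Matrix (Fin d) (Fin d) ℝ) *ᵥ ∑ t, c (rep v) t • rep v t := by
        rw [hh, ← hc]
      _ = ∑ t, c (rep v) t • rotate Q (rep v) t := by
        rw [Matrix.mulVec_sum]
        simp [Matrix.mulVec_smul, rotate]
      _ = ∑ t, c (rep v) t • v t := by rw [hQ]

/-! ### Gaussian moments and Stein's identity -/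

open MeasureTheory ProbabilityTheory in
theorem integrable_pow_gaussianReal (k : ℕ) :
    Integrable (fun x : ℝ => x ^ k) (gaussianReal 0 1) := by
  have h : MemLp id k (gaussianReal 0 1) := memLp_id_gaussianReal' (k : ENNReal) (by simp)
  have h2 := h.integrable_norm_pow'
  refine (integrable_norm_iff (by fun_prop)).1 ?_
  simpa using h2

open MeasureTheory ProbabilityTheory in
/-- The moment recursion of the standard Gaussian, from integration by parts. -/
theorem integral_pow_succ_gaussianReal (k : ℕ) :
    ∫ x, x ^ (k + 1) ∂(gaussianReal 0 1) = k * ∫ x, x ^ (k - 1) ∂(gaussianReal 0 1) := by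
  have hint : ∀ m : ℕ, Integrable (fun x : ℝ => x ^ m * gaussianPDFReal 0 1 x) := by
    intro m
    have h := integrable_pow_gaussianReal m
    rw [gaussianReal_of_var_ne_zero _ one_ne_zero, integrable_withDensity_iff_integrable_smul'
      (measurable_gaussianPDF _ _) (ae_of_all _ fun _ => gaussianPDF_lt_top)] at h
    refine h.congr (ae_of_all _ fun x => ?_)
    simp [mul_comm]
  have hv : ∀ x : ℝ, HasDerivAt (gaussianPDFReal 0 1) (-(x * gaussianPDFReal 0 1 x)) x := by
    intro x
    have h1 : HasDerivAt (fun y : ℝ => -(y - 0) ^ 2 / (2 * ((1 : NNReal) : ℝ))) (-x) x := by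
      have := (((hasDerivAt_id x).sub_const 0).pow 2).neg.div_const (2 * ((1 : NNReal) : ℝ))
      exact this.congr_deriv (by simp; ring)
    have h2 := h1.exp.const_mul ((√(2 * Real.pi * ((1 : NNReal) : ℝ)))⁻¹)
    rw [gaussianPDFReal_def]
    exact h2.congr_deriv (by ring)
  have hu : ∀ x : ℝ, HasDerivAt (fun y : ℝ => y ^ k) (k * x ^ (k - 1)) x := fun x =>
    hasDerivAt_pow k x
  have key := integral_mul_deriv_eq_deriv_mul_of_integrable
    (u := fun y : ℝ => y ^ k) (v := gaussianPDFReal 0 1)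
    (u' := fun x => k * x ^ (k - 1)) (v' := fun x => -(x * gaussianPDFReal 0 1 x))
    (fun x _ => hu x) (fun x _ => hv x)
    (by
      refine (hint (k + 1)).neg.congr (ae_of_all _ fun x => ?_)
      simp only [Pi.neg_apply, Pi.mul_apply]; ring)
    (by
      refine ((hint (k - 1)).const_mul (k : ℝ)).congr (ae_of_all _ fun x => ?_)
      simp only [Pi.mul_apply]; ring)
    (hint k)
  rw [integral_gaussianReal_eq_integral_smul one_ne_zero,
    integral_gaussianReal_eq_integral_smul one_ne_zero, ← integral_const_mul]
  simp only [mul_neg, integral_neg, neg_inj] at key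
  calc _ = ∫ x : ℝ, x ^ k * (x * gaussianPDFReal 0 1 x) := by
        congr 1; ext x; simp only [smul_eq_mul]; ring
    _ = _ := key
    _ = _ := by congr 1; ext x; simp only [smul_eq_mul]; ring

/-- The standard Gaussian measure on `ι → ℝ`. -/
noncomputable def piGaussian (ι : Type*) [Fintype ι] : MeasureTheory.Measure (ι → ℝ) :=
  MeasureTheory.Measure.pi fun _ => ProbabilityTheory.gaussianReal 0 1

open MeasureTheory ProbabilityTheory in
-- Needed so that a continuous function vanishing almost everywhere vanishes identically.
instance piGaussian.isOpenPosMeasure (ι : Type*) [Fintype ι] :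
    (piGaussian ι).IsOpenPosMeasure := by
  have : (gaussianReal 0 1).IsOpenPosMeasure :=
    (gaussianReal_absolutelyContinuous' 0 one_ne_zero).isOpenPosMeasure
  unfold piGaussian; infer_instance

section
variable {ι : Type*} [Fintype ι]
open MeasureTheory MvPolynomial

theorem MvPolynomial.integrable_eval_piGaussian (p : MvPolynomial ι ℝ) :
    Integrable (fun x => eval x p) (piGaussian ι) := by
  induction p using MvPolynomial.induction_on' with
  | monomial α a =>
    simp only [eval_monomial, Finsupp.prod_fintype, pow_zero, implies_true]
    exact (Integrable.fintype_prod fun i => integrable_pow_gaussianReal (α i)).const_mul a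
  | add p q hp hq =>
    simp only [map_add]
    exact hp.add hq

/-- Gaussian expectation of a polynomial. -/
noncomputable def gaussianExpectation (ι : Type*) [Fintype ι] : MvPolynomial ι ℝ →ₗ[ℝ] ℝ where
  toFun p := ∫ x, eval x p ∂(piGaussian ι)
  map_add' p q := by
    simp only [map_add]
    exact integral_add p.integrable_eval_piGaussian q.integrable_eval_piGaussian
  map_smul' c p := by
    simp only [smul_eval, RingHom.id_apply, smul_eq_mul]
    exact integral_const_mul _ _

theorem gaussianExpectation_apply (p : MvPolynomial ι ℝ) :
    gaussianExpectation ι p = ∫ x, eval x p ∂(piGaussian ι) := rfl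

theorem gaussianExpectation_monomial (α : ι →₀ ℕ) (a : ℝ) :
    gaussianExpectation ι (monomial α a) =
      a * ∏ i, ∫ x, x ^ α i ∂(ProbabilityTheory.gaussianReal 0 1) := by
  rw [gaussianExpectation_apply]
  simp only [eval_monomial, Finsupp.prod_fintype, pow_zero, implies_true]
  rw [integral_const_mul, piGaussian,
    integral_fintype_prod_eq_prod (f := fun i (x : ℝ) => x ^ α i)]

/-- Stein's identity for polynomials. -/
theorem gaussianExpectation_X_mul (i : ι) (p : MvPolynomial ι ℝ) :
    gaussianExpectation ι (X i * p) = gaussianExpectation ι (pderiv i p) := by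
  classical
  induction p using MvPolynomial.induction_on' with
  | monomial α a =>
    rw [X, monomial_mul, one_mul, pderiv_monomial, gaussianExpectation_monomial,
      gaussianExpectation_monomial, ← Finset.mul_prod_erase _ _ (Finset.mem_univ i),
      ← Finset.mul_prod_erase _ _ (Finset.mem_univ i)]
    have h : ∀ j ∈ Finset.univ.erase i,
        ∫ x, x ^ (Finsupp.single i 1 + α : ι →₀ ℕ) j ∂(ProbabilityTheory.gaussianReal 0 1) =
        ∫ x, x ^ (α - Finsupp.single i 1 : ι →₀ ℕ) j ∂(ProbabilityTheory.gaussianReal 0 1) := by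
      intro j hj
      have hji : i ≠ j := (Finset.ne_of_mem_erase hj).symm
      simp [hji]
    rw [Finset.prod_congr rfl h]
    have h0 : (Finsupp.single i 1 + α : ι →₀ ℕ) i = α i + 1 := by simp [add_comm]
    have h1 : (α - Finsupp.single i 1 : ι →₀ ℕ) i = α i - 1 := by simp
    rw [h0, h1, integral_pow_succ_gaussianReal]
    ring
  | add p q hp hq => rw [mul_add, map_add, map_add, map_add, hp, hq]

theorem Derivation.leibniz_finset_prod {R A κ : Type*} [CommSemiring R] [CommSemiring A]
    [Algebra R A] [DecidableEq κ] (D : Derivation R A A) (s : Finset κ) (g : κ → A) :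
    D (∏ j ∈ s, g j) = ∑ j ∈ s, (∏ l ∈ s.erase j, g l) * D (g j) := by
  induction s using Finset.induction_on with
  | empty => simp
  | insert a s ha ih =>
    rw [Finset.prod_insert ha, D.leibniz, ih, Finset.sum_insert ha, Finset.erase_insert ha,
      add_comm]
    simp only [smul_eq_mul, Finset.mul_sum]
    congr 1
    refine Finset.sum_congr rfl fun j hj => ?_
    have hja : a ≠ j := fun h => ha (h ▸ hj)
    rw [Finset.erase_insert_of_ne hja, Finset.prod_insert (fun h => ha (Finset.mem_of_mem_erase h)),
      mul_assoc]

end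

/-! ### Polynomials of bounded degree and their kernel -/

/-- A function in the span of finitely many features is a combination of sections of the kernel
that these features define. -/
theorem exists_kernel_combination {X R : Type*} [Fintype R] (Φ : R → X → ℝ) {f : X → ℝ}
    (hf : f ∈ Submodule.span ℝ (Set.range Φ)) :
    ∃ (s : Finset X) (b : X → ℝ), ∀ x, f x = ∑ a ∈ s, b a * ∑ r, Φ r a * Φ r x := by
  obtain ⟨c, rfl⟩ := (Submodule.mem_span_range_iff_exists_fun ℝ).1 hf
  let φ : X → EuclideanSpace ℝ R := fun x => WithLp.toLp 2 fun r => Φ r x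
  have hφ : ∀ (u : EuclideanSpace ℝ R) x, inner ℝ u (φ x) = ∑ r, u r * Φ r x := fun u x => by
    simp [PiLp.inner_apply, φ, mul_comm]
  -- The component of `c` orthogonal to all feature vectors `φ x` does not affect `f`.
  obtain ⟨y, hy, z, hz, hyz⟩ := (Submodule.span ℝ (Set.range φ)).exists_add_mem_mem_orthogonal
    (WithLp.toLp 2 c)
  obtain ⟨b, rfl⟩ := Finsupp.mem_span_range_iff_exists_finsupp.1 hy
  refine ⟨b.support, b, fun x => ?_⟩
  have h1 : inner ℝ z (φ x) = 0 := by
    rw [real_inner_comm]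
    exact hz _ (Submodule.subset_span ⟨x, rfl⟩)
  have h2 : ∑ r, c r * Φ r x = inner ℝ (WithLp.toLp 2 c) (φ x) := (hφ _ x).symm
  rw [hyz, inner_add_left, h1, add_zero, Finsupp.sum, sum_inner] at h2
  simp only [Finset.sum_apply, Pi.smul_apply, smul_eq_mul]
  rw [h2]
  refine Finset.sum_congr rfl fun a _ => ?_
  rw [real_inner_smul_left, hφ]

section
variable {d n : ℕ}

/-- The coordinates of a tuple, together with a constant coordinate `1`. -/
def affineCoord (v : VecTuple d n) (o : Option (Fin n × Fin d)) : ℝ :=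
  o.elim 1 fun p => v p.1 p.2

/-- Products of `k` coordinates, each possibly the constant one. -/
def coordProduct (k : ℕ) (r : Fin k → Option (Fin n × Fin d)) (v : VecTuple d n) : ℝ :=
  ∏ s, affineCoord v (r s)

variable (d n) in
/-- The polynomial functions of degree at most `k`. -/
def polySpan (k : ℕ) : Submodule ℝ (VecTuple d n → ℝ) :=
  Submodule.span ℝ (Set.range (coordProduct k))

theorem mul_affineCoord_mem_polySpan {k : ℕ} {f : VecTuple d n → ℝ} (hf : f ∈ polySpan d n k)
    (o : Option (Fin n × Fin d)) : (fun v => f v * affineCoord v o) ∈ polySpan d n (k + 1) := by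
  induction hf using Submodule.span_induction with
  | mem f hf =>
    obtain ⟨r, rfl⟩ := hf
    refine Submodule.subset_span ⟨Fin.cons o r, ?_⟩
    funext v
    simp [coordProduct, Fin.prod_univ_succ, mul_comm]
  | zero =>
    convert (polySpan d n (k + 1)).zero_mem using 1
    funext v; simp
  | add f g _ _ hf hg =>
    convert (polySpan d n (k + 1)).add_mem hf hg using 1
    funext v; simp [add_mul]
  | smul c f _ hf =>
    convert (polySpan d n (k + 1)).smul_mem c hf using 1
    funext v; simp [mul_assoc]

theorem polySpan_mono : Monotone (polySpan d n) :=
  monotone_nat_of_le_succ fun k f hf => by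
    simpa [affineCoord] using mul_affineCoord_mem_polySpan hf none

theorem IsPolynomialScalar.exists_mem_polySpan {f : VecTuple d n → ℝ}
    (hf : IsPolynomialScalar f) : ∃ k, f ∈ polySpan d n k := by
  obtain ⟨p, hp⟩ := hf
  obtain rfl : f = fun v => MvPolynomial.eval (fun ik => v ik.1 ik.2) p := funext hp
  clear hp
  induction p using MvPolynomial.induction_on with
  | C a =>
    refine ⟨0, ?_⟩
    have : coordProduct 0 (Fin.elim0 : Fin 0 → Option (Fin n × Fin d)) ∈ polySpan d n 0 :=
      Submodule.subset_span ⟨_, rfl⟩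
    convert (polySpan d n 0).smul_mem a this using 1
    funext v; simp [coordProduct]
  | add p q hp hq =>
    obtain ⟨k, hk⟩ := hp
    obtain ⟨l, hl⟩ := hq
    refine ⟨max k l, ?_⟩
    simp only [map_add]
    exact (polySpan d n _).add_mem (polySpan_mono (le_max_left k l) hk)
      (polySpan_mono (le_max_right k l) hl)
  | mul_X p i hp =>
    obtain ⟨k, hk⟩ := hp
    refine ⟨k + 1, ?_⟩
    simpa [affineCoord] using mul_affineCoord_mem_polySpan hk (some i)

/-- Expanding the power gives one term per choice of `k` coordinates; the constant coordinate
accounts for the `1`. -/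
theorem sum_coordProduct_mul (k : ℕ) (v w : VecTuple d n) :
    ∑ r, coordProduct k r v * coordProduct k r w = (1 + ∑ i, v i ⬝ᵥ w i) ^ k := by
  simp only [coordProduct, ← Finset.prod_mul_distrib]
  rw [← Fintype.sum_pow (fun o => affineCoord v o * affineCoord w o)]
  simp [Fintype.sum_option, affineCoord, Fintype.sum_prod_type, dotProduct]

/-- A matrix acting on each vector of a tuple. -/
def mulTuple (G : Matrix (Fin d) (Fin d) ℝ) (v : VecTuple d n) : VecTuple d n :=
  fun i => G *ᵥ v i

/-- The kernel sees only `∑ i, v i ⬝ᵥ w i`, so `Bᵀ` moves to the other argument. -/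
theorem sum_coordProduct_mul_mulTuple (k : ℕ) (B : Matrix (Fin d) (Fin d) ℝ)
    (v w : VecTuple d n) :
    ∑ r, coordProduct k r v * coordProduct k r (mulTuple (Bᵀ * B) w) =
      ∑ r, coordProduct k r (mulTuple B v) * coordProduct k r (mulTuple B w) := by
  rw [sum_coordProduct_mul, sum_coordProduct_mul]
  simp [mulTuple, ← Matrix.mulVec_mulVec, Matrix.dotProduct_mulVec, Matrix.vecMul_transpose]

theorem sum_sum_kernel {X R : Type*} [Fintype R] (Φ : R → X → ℝ) (T : X → X) (s : Finset X)
    (b : X → ℝ) :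
    ∑ a' ∈ s, b a' * ∑ a ∈ s, b a * ∑ r, Φ r (T a) * Φ r (T a') =
      ∑ r, (∑ a ∈ s, b a * Φ r (T a)) ^ 2 := by
  simp only [sq, Finset.sum_mul_sum]
  rw [Finset.sum_comm]
  refine Finset.sum_congr rfl fun a' _ => ?_
  rw [Finset.sum_comm, Finset.mul_sum]
  refine Finset.sum_congr rfl fun a _ => ?_
  rw [Finset.mul_sum, Finset.mul_sum]
  refine Finset.sum_congr rfl fun r _ => ?_
  ring

end

/-! ### Gaussian averaging and the first fundamental theorem -/

section
variable {d n : ℕ}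
open MvPolynomial MeasureTheory

variable (d n) in
/-- The algebra generated by the inner products of the vectors of a tuple. -/
def gramAlgebra : Subalgebra ℝ (VecTuple d n → ℝ) :=
  Algebra.adjoin ℝ (Set.range fun (ij : Fin n × Fin n) (v : VecTuple d n) => v ij.1 ⬝ᵥ v ij.2)

theorem dotProduct_mem_gramAlgebra (i j : Fin n) :
    (fun v : VecTuple d n => v i ⬝ᵥ v j) ∈ gramAlgebra d n :=
  Algebra.subset_adjoin ⟨(i, j), rfl⟩

/-- The affine coordinates of `G v`, as polynomials in the entries of `G`. -/
noncomputable def entryForm (v : VecTuple d n) (o : Option (Fin n × Fin d)) :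
    MvPolynomial (Fin d × Fin d) ℝ :=
  o.elim 1 fun p => ∑ b, C (v p.1 b) * X (p.2, b)

/-- The matrix with given entries. -/
def entryMatrix (x : Fin d × Fin d → ℝ) : Matrix (Fin d) (Fin d) ℝ := fun a b => x (a, b)

theorem eval_entryForm (x : Fin d × Fin d → ℝ) (v : VecTuple d n)
    (o : Option (Fin n × Fin d)) :
    eval x (entryForm v o) = affineCoord (mulTuple (entryMatrix x) v) o := by
  cases o with
  | none => simp [entryForm, affineCoord]
  | some p =>
    simp [entryForm, affineCoord, mulTuple, Matrix.mulVec, dotProduct, entryMatrix, mul_comm]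

theorem eval_prod_entryForm {k : ℕ} (r : Fin k → Option (Fin n × Fin d))
    (x : Fin d × Fin d → ℝ) (v : VecTuple d n) :
    eval x (∏ s, entryForm v (r s)) = coordProduct k r (mulTuple (entryMatrix x) v) := by
  rw [map_prod]
  exact Finset.prod_congr rfl fun s _ => eval_entryForm x v (r s)

/-- Wick's formula, in qualitative form: the Gaussian expectation of a product of entries of `G v`
is a polynomial in the inner products of the `vᵢ`. -/
theorem gaussianExpectation_prod_entryForm_mem_gramAlgebra {κ : Type*} [DecidableEq κ]
    (r : κ → Option (Fin n × Fin d)) (m : ℕ) (s : Finset κ) (hs : s.card = m) :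
    (fun v : VecTuple d n => gaussianExpectation _ (∏ l ∈ s, entryForm v (r l)))
      ∈ gramAlgebra d n := by
  induction m using Nat.strong_induction_on generalizing s with
  | _ m ih =>
  rcases s.eq_empty_or_nonempty with rfl | ⟨l₀, hl₀⟩
  · simp only [Finset.prod_empty]
    exact (gramAlgebra d n).algebraMap_mem (gaussianExpectation (Fin d × Fin d) 1)
  have hlt : ∀ t ⊆ s.erase l₀, t.card < m := fun t ht =>
    (Finset.card_le_card ht).trans_lt (hs ▸ Finset.card_erase_lt_of_mem hl₀)
  rcases hr : r l₀ with _ | ⟨i, a⟩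
  · convert ih _ (hlt _ subset_rfl) (s.erase l₀) rfl using 1
    funext v
    rw [← Finset.mul_prod_erase _ _ hl₀, hr]
    simp [entryForm]
  -- The covariance of entry `a` of `G (v i)` with the entry `o`; the constant coordinate has
  -- covariance zero.
  let c : Option (Fin n × Fin d) → VecTuple d n → ℝ := fun o v =>
    o.elim 0 fun p => if a = p.2 then v i ⬝ᵥ v p.1 else 0
  have hc : ∀ o, c o ∈ gramAlgebra d n := by
    rintro (_ | ⟨j, a'⟩)
    · exact (gramAlgebra d n).zero_mem
    · by_cases h : a = a'
      · simpa [c, h] using dotProduct_mem_gramAlgebra i j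
      · convert (gramAlgebra d n).zero_mem using 1
        funext v; simp [c, h]
  have key : (fun v : VecTuple d n => gaussianExpectation _ (∏ l ∈ s, entryForm v (r l))) =
      ∑ l ∈ s.erase l₀, (fun v : VecTuple d n =>
        gaussianExpectation _ (∏ l' ∈ (s.erase l₀).erase l, entryForm v (r l'))) * c (r l) := by
    funext v
    have hD : ∀ o, ∑ b, v i b • pderiv (a, b) (entryForm v o) = C (c o v) := by
      rintro (_ | ⟨j, a'⟩)
      · simp [entryForm, c]
      · by_cases h : a = a'
        · subst h
          simp [entryForm, c, pderiv_X, Pi.single_apply, dotProduct, smul_eq_C_mul]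
        · simp [entryForm, c, h, pderiv_X, Ne.symm h]
    have hstein : ∀ P : MvPolynomial (Fin d × Fin d) ℝ,
        gaussianExpectation _ (entryForm v (some (i, a)) * P) =
          gaussianExpectation _ (∑ b, v i b • pderiv (a, b) P) := by
      intro P
      simp only [entryForm, Option.elim_some, Finset.sum_mul, map_sum,
        ← smul_eq_C_mul, smul_mul_assoc, map_smul, gaussianExpectation_X_mul]
    have hleib : ∀ t : Finset κ, ∑ b, v i b • pderiv (a, b) (∏ l ∈ t, entryForm v (r l)) =
        ∑ l ∈ t, c (r l) v • ∏ l' ∈ t.erase l, entryForm v (r l') := by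
      intro t
      simp only [Derivation.leibniz_finset_prod, Finset.smul_sum]
      rw [Finset.sum_comm]
      refine Finset.sum_congr rfl fun l _ => ?_
      rw [smul_eq_C_mul, ← hD, mul_comm, Finset.mul_sum]
      simp only [mul_smul_comm]
    rw [← Finset.mul_prod_erase _ _ hl₀, hr, hstein, hleib, map_sum, Finset.sum_apply]
    refine Finset.sum_congr rfl fun l _ => ?_
    rw [map_smul, smul_eq_mul, mul_comm]
    rfl
  rw [key]
  exact (gramAlgebra d n).sum_mem fun l _ => (gramAlgebra d n).mul_mem
    (ih _ (hlt _ (Finset.erase_subset _ _)) _ rfl) (hc _)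

/-- Each factor is linear in the affine coordinates of `v`, with coefficients `W` independent of
`v`. Hence averaging preserves the degree bound. -/
theorem gaussianExpectation_prod_entryForm_mem_polySpan {k : ℕ}
    (r : Fin k → Option (Fin n × Fin d)) :
    (fun v : VecTuple d n => gaussianExpectation _ (∏ l, entryForm v (r l)))
      ∈ polySpan d n k := by
  classical
  let W : Option (Fin n × Fin d) → Option (Fin n × Fin d) → MvPolynomial (Fin d × Fin d) ℝ :=
    fun o o' => o.elim (o'.elim 1 fun _ => 0) fun p => o'.elim 0 fun q =>
      if p.1 = q.1 then X (p.2, q.2) else 0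
  have hW : ∀ (v : VecTuple d n) o, entryForm v o = ∑ o', C (affineCoord v o') * W o o' := by
    rintro v (_ | ⟨i, a⟩)
    · simp [entryForm, W, Fintype.sum_option, affineCoord]
    · simp [entryForm, W, Fintype.sum_option, affineCoord, Fintype.sum_prod_type]
  have key : (fun v : VecTuple d n => gaussianExpectation _ (∏ l, entryForm v (r l))) =
      ∑ r', gaussianExpectation _ (∏ l, W (r l) (r' l)) • coordProduct k r' := by
    funext v
    simp only [hW, Finset.prod_univ_sum, Finset.prod_mul_distrib, map_sum, Finset.sum_apply,
      Fintype.piFinset_univ, Pi.smul_apply, smul_eq_mul]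
    refine Finset.sum_congr rfl fun r' _ => ?_
    rw [← map_prod, ← smul_eq_C_mul, map_smul, smul_eq_mul, mul_comm]
    rfl
  rw [key]
  exact Submodule.sum_mem _ fun r' _ => Submodule.smul_mem _ _ (Submodule.subset_span ⟨r', rfl⟩)

theorem exists_eval_eq_of_mem_polySpan {k : ℕ} {f : VecTuple d n → ℝ} (hf : f ∈ polySpan d n k)
    (v : VecTuple d n) : ∃ p : MvPolynomial (Fin d × Fin d) ℝ,
      ∀ x, f (mulTuple (entryMatrix x) v) = eval x p := by
  obtain ⟨c, rfl⟩ := (Submodule.mem_span_range_iff_exists_fun ℝ).1 hf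
  refine ⟨∑ r, C (c r) * ∏ s, entryForm v (r s), fun x => ?_⟩
  simp [eval_prod_entryForm, -map_prod]

/-- Averaging a polynomial function over Gaussian random matrices. -/
noncomputable def gaussianAverage (k : ℕ) : polySpan d n k →ₗ[ℝ] VecTuple d n → ℝ where
  toFun f v := ∫ x, f.1 (mulTuple (entryMatrix x) v) ∂(piGaussian (Fin d × Fin d))
  map_add' f g := by
    funext v
    obtain ⟨p, hp⟩ := exists_eval_eq_of_mem_polySpan f.2 v
    obtain ⟨q, hq⟩ := exists_eval_eq_of_mem_polySpan g.2 v
    simp only [Submodule.coe_add, Pi.add_apply, hp, hq]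
    exact integral_add p.integrable_eval_piGaussian q.integrable_eval_piGaussian
  map_smul' c f := by
    funext v
    exact integral_const_mul _ _

theorem gaussianAverage_mem {k : ℕ} (f : polySpan d n k) :
    gaussianAverage k f ∈ gramAlgebra d n ∧ gaussianAverage k f ∈ polySpan d n k := by
  classical
  have hr : ∀ r (h : coordProduct k r ∈ polySpan d n k), gaussianAverage k ⟨coordProduct k r, h⟩ =
      fun v : VecTuple d n => gaussianExpectation _ (∏ l, entryForm v (r l)) := by
    intro r h
    funext v
    rw [gaussianExpectation_apply]
    simp only [eval_prod_entryForm]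
    rfl
  obtain ⟨c, hc⟩ := (Submodule.mem_span_range_iff_exists_fun ℝ).1 f.2
  have hmem : ∀ r, coordProduct k r ∈ polySpan d n k := fun r => Submodule.subset_span ⟨r, rfl⟩
  have hf : f = ∑ r, c r • (⟨coordProduct k r, hmem r⟩ : polySpan d n k) := by
    refine Subtype.ext ?_
    rw [← hc, Submodule.coe_sum]
    rfl
  rw [hf, map_sum]
  simp only [map_smul, hr]
  exact ⟨Subalgebra.sum_mem _ fun r _ => Subalgebra.smul_mem _
      (gaussianExpectation_prod_entryForm_mem_gramAlgebra r _ Finset.univ rfl) _,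
    Submodule.sum_mem _ fun r _ => Submodule.smul_mem _ _
      (gaussianExpectation_prod_entryForm_mem_polySpan r)⟩

/-- Gaussian averaging is injective on invariant polynomial functions. -/
theorem eq_zero_of_gaussianAverage_eq_zero {k : ℕ} {f : polySpan d n k}
    (hf : IsOInvariant f.1) (h0 : gaussianAverage k f = 0) : f.1 = 0 := by
  obtain ⟨s, b, hfs⟩ := exists_kernel_combination (coordProduct k) f.2
  let F : (Fin d × Fin d → ℝ) → ℝ := fun x => ∑ a ∈ s, b a * f.1 (mulTuple (entryMatrix x) a)
  choose p hp using exists_eval_eq_of_mem_polySpan f.2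
  have hF : F = fun x => eval x (∑ a ∈ s, C (b a) * p a) := by
    funext x
    simp [F, hp]
  have hFc : Continuous F := by rw [hF]; exact MvPolynomial.continuous_eval _
  have hFi : Integrable F (piGaussian (Fin d × Fin d)) := by
    rw [hF]; exact MvPolynomial.integrable_eval_piGaussian _
  have hF0 : 0 ≤ F := by
    intro x
    -- Invariance removes `Q`; moving `Bᵀ` across the kernel turns `F x` into a sum of squares.
    obtain ⟨Q, B, hQB⟩ := Matrix.exists_orthogonalGroup_mul_transpose_mul_self (entryMatrix x)
    have h1 : ∀ a, f.1 (mulTuple (entryMatrix x) a) = f.1 (mulTuple (Bᵀ * B) a) := by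
      intro a
      rw [← hf Q (mulTuple (Bᵀ * B) a), hQB]
      exact congrArg f.1 (funext fun i => (Matrix.mulVec_mulVec _ _ _).symm)
    simp only [F, h1]
    simp only [hfs, sum_coordProduct_mul_mulTuple]
    rw [sum_sum_kernel]
    exact Finset.sum_nonneg fun _ _ => sq_nonneg _
  have hint : ∫ x, F x ∂(piGaussian (Fin d × Fin d)) = 0 := by
    simp only [F]
    rw [integral_finsetSum]
    · refine Finset.sum_eq_zero fun a _ => ?_
      rw [integral_const_mul]
      exact mul_eq_zero_of_right _ (congrFun h0 a)
    · intro a _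
      simp only [hp]
      exact (p a).integrable_eval_piGaussian.const_mul _
  -- `F` is continuous and nonnegative with integral zero. At the identity matrix its squares are
  -- those of the coefficients of `f` in the features, so `f` vanishes.
  have hz : F = 0 := by
    have := (integral_eq_zero_iff_of_nonneg hF0 hFi).1 hint
    exact (hFc.ae_eq_iff_eq _ continuous_zero).1 this
  have h1 := congrFun hz fun ab => (1 : Matrix (Fin d) (Fin d) ℝ) ab.1 ab.2
  have hone : ∀ a : VecTuple d n,
      mulTuple (entryMatrix fun ab => (1 : Matrix (Fin d) (Fin d) ℝ) ab.1 ab.2) a = a := by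
    intro a
    funext i
    exact Matrix.one_mulVec _
  rw [Pi.zero_apply] at h1
  simp only [F, hone, hfs] at h1
  have h2 := sum_sum_kernel (coordProduct k) id s b
  simp only [id] at h2
  rw [h2, Finset.sum_eq_zero_iff_of_nonneg fun _ _ => sq_nonneg _] at h1
  funext x
  rw [hfs]
  simp only [Finset.mul_sum]
  rw [Finset.sum_comm]
  refine Finset.sum_eq_zero fun r _ => ?_
  have := pow_eq_zero_iff (two_ne_zero) |>.1 (h1 r (Finset.mem_univ _))
  simp only [← mul_assoc, ← Finset.sum_mul]
  exact mul_eq_zero_of_left this _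

theorem isOInvariant_of_mem_gramAlgebra {f : VecTuple d n → ℝ} (hf : f ∈ gramAlgebra d n) :
    IsOInvariant f := by
  induction hf using Algebra.adjoin_induction with
  | mem f hf =>
    obtain ⟨ij, rfl⟩ := hf
    intro Q v
    have hQ := (Matrix.mem_orthogonalGroup_iff' _ _).1 Q.2
    simp only [rotate, Matrix.dotProduct_mulVec, Matrix.vecMul_mulVec]
    rw [show (Q : Matrix (Fin d) (Fin d) ℝ)ᵀ * (Q : Matrix (Fin d) (Fin d) ℝ) = 1 from hQ]
    simp
  | algebraMap c => intro Q v; rfl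
  | add f g _ _ hf hg => intro Q v; simp only [Pi.add_apply, hf Q v, hg Q v]
  | mul f g _ _ hf hg => intro Q v; simp only [Pi.mul_apply, hf Q v, hg Q v]

/-- The first fundamental theorem of invariant theory for the orthogonal group. -/
theorem IsOInvariant.mem_gramAlgebra {f : VecTuple d n → ℝ} (hf : IsOInvariant f)
    (hp : IsPolynomialScalar f) : f ∈ gramAlgebra d n := by
  obtain ⟨k, hk⟩ := hp.exists_mem_polySpan
  let V : Submodule ℝ (polySpan d n k) :=
    { carrier := {f | IsOInvariant f.1}
      add_mem' := fun {f g} hf hg Q v => congrArg₂ (· + ·) (hf Q v) (hg Q v)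
      zero_mem' := fun Q v => rfl
      smul_mem' := fun c f hf Q v => congrArg (c * ·) (hf Q v) }
  let A : V →ₗ[ℝ] V :=
    { toFun := fun f => ⟨⟨gaussianAverage k f.1, (gaussianAverage_mem f.1).2⟩,
        isOInvariant_of_mem_gramAlgebra (gaussianAverage_mem f.1).1⟩
      map_add' := fun f g => Subtype.ext (Subtype.ext (map_add (gaussianAverage k) f.1 g.1))
      map_smul' := fun c f => Subtype.ext (Subtype.ext (map_smul (gaussianAverage k) c f.1)) }
  have : FiniteDimensional ℝ (polySpan d n k) :=
    FiniteDimensional.span_of_finite ℝ (Set.finite_range _)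
  have hinj : Function.Injective A := by
    rw [injective_iff_map_eq_zero]
    intro g hg
    exact Subtype.ext (Subtype.ext (eq_zero_of_gaussianAverage_eq_zero g.2
      (congrArg (fun u : V => u.1.1) hg)))
  have hsurj : Function.Surjective A := by
    exact (LinearMap.surjective_of_injective (K := ℝ) (V := V) hinj)
  obtain ⟨g, hg⟩ := hsurj ⟨⟨f, hk⟩, hf⟩
  have := (gaussianAverage_mem g.1).1
  rwa [show gaussianAverage k g.1 = f from congrArg (fun u : V => u.1.1) hg] at this

end

/-! ### From invariants to equivariant maps -/

section
variable {d n : ℕ}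

theorem isPolynomialInInnerProducts_of_mem_gramAlgebra {f : VecTuple d n → ℝ}
    (hf : f ∈ gramAlgebra d n) : IsPolynomialInInnerProducts f := by
  rw [gramAlgebra, Algebra.adjoin_range_eq_range_aeval] at hf
  obtain ⟨g, rfl⟩ := hf
  refine ⟨g, fun v => ?_⟩
  change Pi.evalAlgHom ℝ (fun _ : VecTuple d n => ℝ) v (MvPolynomial.aeval _ g) = _
  rw [← AlgHom.comp_apply, MvPolynomial.comp_aeval, MvPolynomial.aeval_eq_eval]
  rfl

theorem IsPolynomialInInnerProducts.isPolynomialScalar {f : VecTuple d n → ℝ}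
    (hf : IsPolynomialInInnerProducts f) : IsPolynomialScalar f := by
  obtain ⟨g, hg⟩ := hf
  refine ⟨MvPolynomial.bind₁ (fun ij : Fin n × Fin n =>
    ∑ k, MvPolynomial.X (ij.1, k) * MvPolynomial.X (ij.2, k)) g, fun v => ?_⟩
  rw [hg, ← MvPolynomial.aeval_eq_eval, ← MvPolynomial.aeval_eq_eval, MvPolynomial.aeval_bind₁]
  simp [dotProduct]

/-- The part of first order in one vector of a polynomial in inner products. -/
theorem exists_hasDerivAt_of_mem_gramAlgebra {F : VecTuple d (n + 1) → ℝ}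
    (hF : F ∈ gramAlgebra d (n + 1)) :
    ∃ g₀ ∈ gramAlgebra d n, ∃ g : Fin n → VecTuple d n → ℝ, (∀ t, g t ∈ gramAlgebra d n) ∧
      ∀ (w : Fin d → ℝ) (v : VecTuple d n), F (Fin.cons 0 v) = g₀ v ∧
        HasDerivAt (fun s : ℝ => F (Fin.cons (s • w) v)) (∑ t, g t v * (v t ⬝ᵥ w)) 0 := by
  induction hF using Algebra.adjoin_induction with
  | mem F hF =>
    obtain ⟨⟨i, j⟩, rfl⟩ := hF
    refine Fin.cases ?_ (fun i => ?_) i <;> refine Fin.cases ?_ (fun j => ?_) j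
    -- The square of the added vector is of second order and contributes nothing.
    · refine ⟨0, zero_mem _, 0, fun t => zero_mem _, fun w v => ⟨by simp, ?_⟩⟩
      have := ((hasDerivAt_id (0 : ℝ)).pow 2).mul_const (w ⬝ᵥ w)
      simp only [Fin.cons_zero, smul_dotProduct, dotProduct_smul, smul_eq_mul, ← mul_assoc, ← sq]
      exact this.congr_deriv (by simp)
    · refine ⟨0, zero_mem _, Pi.single j 1, fun t => ?_, fun w v => ⟨by simp, ?_⟩⟩
      · by_cases h : t = j
        · subst h; simp
        · simp [h]
      have := (hasDerivAt_id (0 : ℝ)).mul_const (w ⬝ᵥ v j)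
      simp only [Fin.cons_zero, Fin.cons_succ, smul_dotProduct, smul_eq_mul]
      refine this.congr_deriv ?_
      rw [Finset.sum_eq_single j] <;> simp +contextual [dotProduct_comm]
    · refine ⟨0, zero_mem _, Pi.single i 1, fun t => ?_, fun w v => ⟨by simp, ?_⟩⟩
      · by_cases h : t = i
        · subst h; simp
        · simp [h]
      have := (hasDerivAt_id (0 : ℝ)).mul_const (v i ⬝ᵥ w)
      simp only [Fin.cons_zero, Fin.cons_succ, dotProduct_smul, smul_eq_mul]
      refine this.congr_deriv ?_
      rw [Finset.sum_eq_single i] <;> simp +contextual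
    · refine ⟨_, dotProduct_mem_gramAlgebra i j, 0, fun t => zero_mem _,
        fun w v => ⟨by simp, ?_⟩⟩
      simpa using hasDerivAt_const (0 : ℝ) (v i ⬝ᵥ v j)
  | algebraMap c =>
    refine ⟨algebraMap ℝ _ c, Subalgebra.algebraMap_mem _ c, 0, fun t => zero_mem _,
      fun w v => ⟨rfl, ?_⟩⟩
    simpa using hasDerivAt_const (0 : ℝ) c
  | add F G _ _ hF hG =>
    obtain ⟨f₀, hf₀, f, hf, hFf⟩ := hF
    obtain ⟨g₀, hg₀, g, hg, hGg⟩ := hG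
    refine ⟨f₀ + g₀, add_mem hf₀ hg₀, f + g, fun t => add_mem (hf t) (hg t), fun w v => ⟨?_, ?_⟩⟩
    · simp [(hFf w v).1, (hGg w v).1]
    · refine ((hFf w v).2.add (hGg w v).2).congr_deriv ?_
      simp [add_mul, Finset.sum_add_distrib]
  | mul F G _ _ hF hG =>
    obtain ⟨f₀, hf₀, f, hf, hFf⟩ := hF
    obtain ⟨g₀, hg₀, g, hg, hGg⟩ := hG
    refine ⟨f₀ * g₀, mul_mem hf₀ hg₀, fun t => f t * g₀ + f₀ * g t,
      fun t => add_mem (mul_mem (hf t) hg₀) (mul_mem hf₀ (hg t)), fun w v => ⟨?_, ?_⟩⟩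
    · simp [(hFf w v).1, (hGg w v).1]
    · refine ((hFf w v).2.mul (hGg w v).2).congr_deriv ?_
      simp only [zero_smul, (hFf w v).1, (hGg w v).1, Pi.add_apply, Pi.mul_apply, add_mul,
        Finset.sum_add_distrib, Finset.sum_mul, Finset.mul_sum]
      congr 1 <;> refine Finset.sum_congr rfl fun t _ => by ring

/-- The pairing of an equivariant map with an additional vector is invariant. -/
theorem IsOEquivariant.isOInvariant_dotProduct {h : VecTuple d n → Fin d → ℝ}
    (hh : IsOEquivariant h) :
    IsOInvariant fun u : VecTuple d (n + 1) => h (Fin.tail u) ⬝ᵥ u 0 := by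
  intro Q u
  have hQ := (Matrix.mem_orthogonalGroup_iff' _ _).1 Q.2
  change h (rotate Q (Fin.tail u)) ⬝ᵥ _ = _
  rw [hh]
  simp only [rotate, Matrix.dotProduct_mulVec, Matrix.vecMul_mulVec]
  rw [show (Q : Matrix (Fin d) (Fin d) ℝ)ᵀ * (Q : Matrix (Fin d) (Fin d) ℝ) = 1 from hQ]
  simp

theorem IsPolynomialVector.isPolynomialScalar_dotProduct {h : VecTuple d n → Fin d → ℝ}
    (hp : IsPolynomialVector h) :
    IsPolynomialScalar fun u : VecTuple d (n + 1) => h (Fin.tail u) ⬝ᵥ u 0 := by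
  choose p hp using hp
  refine ⟨∑ k, MvPolynomial.rename (fun ik : Fin n × Fin d => (ik.1.succ, ik.2)) (p k) *
    MvPolynomial.X (0, k), fun u => ?_⟩
  simp only [dotProduct, hp, map_sum, map_mul, MvPolynomial.eval_rename, MvPolynomial.eval_X]
  rfl

/-- An equivariant polynomial map is a combination of its arguments whose coefficients are
polynomials in the inner products. -/
theorem IsOEquivariant.exists_gramAlgebra_coeff {h : VecTuple d n → Fin d → ℝ}
    (hh : IsOEquivariant h) (hp : IsPolynomialVector h) :
    ∃ f : Fin n → VecTuple d n → ℝ,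
      (∀ t, f t ∈ gramAlgebra d n) ∧ ∀ v : VecTuple d n, h v = ∑ t, f t v • v t := by
  obtain ⟨_, _, g, hg, hgd⟩ := exists_hasDerivAt_of_mem_gramAlgebra
    (hh.isOInvariant_dotProduct.mem_gramAlgebra hp.isPolynomialScalar_dotProduct)
  refine ⟨g, hg, fun v => dotProduct_eq _ _ fun w => ?_⟩
  have h1 := (hgd w v).2
  -- The pairing is linear in the added vector, so its derivative at zero is `h v ⬝ᵥ w` itself.
  have h2 := (hasDerivAt_id (0 : ℝ)).mul_const (h v ⬝ᵥ w)
  simp only [Fin.tail_cons, Fin.cons_zero, dotProduct_smul, smul_eq_mul] at h1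
  rw [sum_dotProduct]
  simpa [smul_dotProduct] using h2.unique h1

end

theorem mainTheorem1 (d n : ℕ) (h : VecTuple d n → Fin d → ℝ) (hh : IsOEquivariant h) :
    (∃ f : Fin n → VecTuple d n → ℝ,
      (∀ t, IsOInvariant (f t)) ∧
      ∀ v : VecTuple d n, h v = ∑ t, f t v • v t) ∧
    (IsPolynomialVector h →
      ∃ f : Fin n → VecTuple d n → ℝ,
        (∀ t, IsOInvariant (f t)) ∧
        (∀ t, IsPolynomialScalar (f t)) ∧
        (∀ t, IsPolynomialInInnerProducts (f t)) ∧
        ∀ v : VecTuple d n, h v = ∑ t, f t v • v t) := by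
  refine ⟨hh.exists_invariant_coeff, fun hp => ?_⟩
  obtain ⟨f, hf, hfv⟩ := hh.exists_gramAlgebra_coeff hp
  have hgram := fun t => isPolynomialInInnerProducts_of_mem_gramAlgebra (hf t)
  exact ⟨f, fun t => isOInvariant_of_mem_gramAlgebra (hf t),
    fun t => (hgram t).isPolynomialScalar, hgram, hfv⟩
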